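/- Let $q\ge 2$, let $\|\cdot\|$ be an arbitrary norm on $\mathbb{R}^q$ with dual norm $\|\cdot\|_*$, and let $\delta^H$ be the Hausdorff distance with respect to $\|\cdot\|$. **Problem.** Let $C\subsetneq\mathbb{R}^q$ be a closed convex solid pointed cone that is polyhedral, $X\subseteq\mathbb{R}^n$ a convex set, $\Gamma\colon X\to\mathbb{R}^q$ continuous and $C$-convex, i.e. $\lambda\Gamma(x_1)+(1-\lambda)\Gamma(x_2)-\Gamma(\lambda x_1+(1-\lambda)x_2)\in C$ for $x_1,x_2\in X$, $\lambda\in[0,1]$, and $\mathcal{X}\subseteq X$ a compact convex set with nonempty interior. Put $\mathcal{P}=\Gamma(\mathcal{X})+C$ (the upper image) and $C^+=\{w: w^{\mathsf T}y\ge 0\ \forall y\in C\}$. **Algorithm (run indefinitely, without stopping criterion).** *Initialization.* Let $w^1,\dots,w^J$ with $\|w^j\|_*=1$ generate the convex cone $C^+$, let $x^j$ minimize $(w^j)^{\mathsf T}\Gamma$ over $\mathcal{X}$, and put $$\mathcal{P}^{\rm out}_0=\bigcap_{j=1}^J\{y:(w^j)^{\mathsf T}y\ge (w^j)^{\mathsf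 T}\Gamma(x^j)\},\qquad \bar w=\frac{\sum_j w^j}{\|\sum_j w^j\|_*}.$$ Let $\beta\ge\sup_{x\in\mathcal{X}}\bar w^{\mathsf T}\Gamma(x)$, let $$\gamma>\sup_{x\in\mathcal{X}}\bar w^{\mathsf T}\Gamma(x)+\max_{v\in{\rm ext}\,\mathcal{P}^{\rm out}_0}(\bar w^{\mathsf T}v-\beta)^++\delta^H(\mathcal{P}^{\rm out}_0,\mathcal{P}),$$ and put $S(\gamma)=\{y:\bar w^{\mathsf T}y\le\gamma\}$ and $\bar{\mathcal{P}}^{\rm out}_0=\mathcal{P}^{\rm out}_0\cap S(\gamma)$. *Iteration $k\ge0$.* For each vertex $v$ of $\bar{\mathcal{P}}^{\rm out}_k$ (unless this was done for the same $v$ before) compute an optimal solution $(x^v,z^v)$ of $$\min\ \|z\|\quad\text{s.t.}\quad v+z-\Gamma(x)\in C,\ \ \bar w^{\mathsf T}(v+z)\le\gamma,\ \ x\in\mathcal{X},\ z\in\mathbb{R}^q,$$ and an optimal solution $(w^v,\lambda^v)$ of its Lagrange dual $$\max_{w\in C^+,\ \lambda\ge0}\ \inf_{x\in\mathcal{X},\,z\in\mathbb{R}^q}\big(\|z\|+w^{\mathsf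 T}(\Gamma(x)-z-v)+\lambda(\bar w^{\mathsf T}(v+z)-\gamma)\big).$$ Choose a vertex $v^k$ of $\bar{\mathcal{P}}^{\rm out}_k$ for which $\|z^v\|$ is maximal, let $\tilde w=w^{v^k}-\lambda^{v^k}\bar w$, and set $$\bar{\mathcal{P}}^{\rm out}_{k+1}=\bar{\mathcal{P}}^{\rm out}_k\cap\{y:\tilde w^{\mathsf T}y\ge\tilde w^{\mathsf T}(v^k+z^{v^k})\}.$$ **Claim.** The approximation error decreases by the order of $\mathcal{O}(k^{1/(1-q)})$, with a constant that, for the given norm, depends only on the compact set $\mathcal{P}\cap S(\gamma)$: there is a function $\Lambda$ from the subsets of $\mathbb{R}^q$ to $\mathbb{R}$ such that for every problem as above, every initialization and every run of the algorithm there is an $N$ such that, for all $k\ge N$, the Hausdorff distance below is finite and $$\delta^H(\bar{\mathcal{P}}^{\rm out}_k+C,\ \mathcal{P})\ \le\ \Lambda(\mathcal{P}\cap S(\gamma))\,k^{1/(1-q)}.$$ -/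

import Mathlib

open scoped Pointwise

noncomputable section

/-- A set is polyhedral if it is the intersection of finitely many closed halfspaces
`{y | b ≤ f y}`. -/
def IsPolyhedralSet {E : Type*} [NormedAddCommGroup E] [NormedSpace ℝ E] (A : Set E) : Prop :=
  ∃ F : Finset (StrongDual ℝ E × ℝ), A = {y | ∀ p ∈ F, p.2 ≤ p.1 y}

/-- The dual cone `C⁺`. Linear functionals `w` play the role of `y ↦ wᵀ y`, so that the norm of
`StrongDual ℝ E` is the dual norm. -/
def dualCone {E : Type*} [NormedAddCommGroup E] [NormedSpace ℝ E] (C : Set E) :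
    Set (StrongDual ℝ E) :=
  {w | ∀ y ∈ C, 0 ≤ w y}

/-- The convex conic hull of `w 0, …, w (J - 1)`. -/
def conicHull {V : Type*} [AddCommGroup V] [Module ℝ V] {J : ℕ} (w : Fin J → V) : Set V :=
  {u | ∃ t : Fin J → ℝ, (∀ j, 0 ≤ t j) ∧ u = ∑ j, t j • w j}

/-- A convex vector optimization problem with decision space `ℝⁿ` and objective space `E`:
minimize `Γ x` with respect to the order of `C` over `x ∈ feas`. Only the values of `Γ` on the
convex set `X` matter. -/
structure CVOP (n : ℕ) (E : Type*) [NormedAddCommGroup E] [NormedSpace ℝ E] where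
  /-- the ordering cone; a `ProperCone` is a closed convex cone containing `0` -/
  C : ProperCone ℝ E
  C_ne_univ : (C : Set E) ≠ Set.univ
  C_solid : (interior (C : Set E)).Nonempty
  C_pointed : ∀ y : E, y ∈ C → -y ∈ C → y = 0
  /-- the convex domain of the objective function -/
  X : Set (EuclideanSpace ℝ (Fin n))
  X_convex : Convex ℝ X
  /-- the objective function -/
  Γ : EuclideanSpace ℝ (Fin n) → E
  Γ_continuousOn : ContinuousOn Γ X
  Γ_coneConvex : ∀ x₁ ∈ X, ∀ x₂ ∈ X, ∀ t : ℝ, 0 ≤ t → t ≤ 1 →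
    t • Γ x₁ + (1 - t) • Γ x₂ - Γ (t • x₁ + (1 - t) • x₂) ∈ C
  /-- the feasible region -/
  feas : Set (EuclideanSpace ℝ (Fin n))
  feas_subset : feas ⊆ X
  feas_compact : IsCompact feas
  feas_convex : Convex ℝ feas
  feas_solid : (interior feas).Nonempty

namespace CVOP

variable {n : ℕ} {E : Type*} [NormedAddCommGroup E] [NormedSpace ℝ E]

/-- The upper image `Γ(feas) + C`. -/
def upperImage (Q : CVOP n E) : Set E := Q.Γ '' Q.feas + (Q.C : Set E)

/-- `x` is an optimal solution of the weighted sum scalarization with weight `w`. -/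
def IsWSOptimal (Q : CVOP n E) (w : StrongDual ℝ E) (x : EuclideanSpace ℝ (Fin n)) : Prop :=
  x ∈ Q.feas ∧ ∀ x' ∈ Q.feas, w (Q.Γ x) ≤ w (Q.Γ x')

/-- Feasibility of `(x, z)` for the modified norm-minimizing scalarization at `v`:
`Γ x - z - v ≤_C 0`, `w̄ (v + z) ≤ γ` and `x ∈ feas`. -/
def PrimalFeasible (Q : CVOP n E) (wbar : StrongDual ℝ E) (γ : ℝ) (v : E)
    (x : EuclideanSpace ℝ (Fin n)) (z : E) : Prop :=
  x ∈ Q.feas ∧ v + z - Q.Γ x ∈ Q.C ∧ wbar (v + z) ≤ γ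

/-- `(x, z)` minimizes `‖z‖` over the feasible pairs. -/
def PrimalOptimal (Q : CVOP n E) (wbar : StrongDual ℝ E) (γ : ℝ) (v : E)
    (x : EuclideanSpace ℝ (Fin n)) (z : E) : Prop :=
  Q.PrimalFeasible wbar γ v x z ∧
    ∀ x' z', Q.PrimalFeasible wbar γ v x' z' → ‖z‖ ≤ ‖z'‖

/-- The objective function of the Lagrange dual, with values in the extended reals. -/
def dualObjective (Q : CVOP n E) (wbar : StrongDual ℝ E) (γ : ℝ) (v : E)
    (w : StrongDual ℝ E) (lam : ℝ) : EReal :=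
  ⨅ x ∈ Q.feas, ⨅ z : E,
    ((‖z‖ + w (Q.Γ x - z - v) + lam * (wbar (v + z) - γ) : ℝ) : EReal)

/-- `(w, lam)` maximizes the dual objective over `C⁺ × [0, ∞)`. -/
def DualOptimal (Q : CVOP n E) (wbar : StrongDual ℝ E) (γ : ℝ) (v : E)
    (w : StrongDual ℝ E) (lam : ℝ) : Prop :=
  w ∈ dualCone (Q.C : Set E) ∧ 0 ≤ lam ∧
    ∀ w' ∈ dualCone (Q.C : Set E), ∀ lam' : ℝ, 0 ≤ lam' →
      Q.dualObjective wbar γ v w' lam' ≤ Q.dualObjective wbar γ v w lam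

/-- The normalized sum `w̄` of a family of weights. -/
def normalizedSum {J : ℕ} (w : Fin J → StrongDual ℝ E) : StrongDual ℝ E :=
  ‖∑ j, w j‖⁻¹ • ∑ j, w j

/-- The polyhedron cut out by the halfspaces `{y | w j (Γ (x j)) ≤ w j y}`. -/
def initialPolyhedron (Q : CVOP n E) {J : ℕ} (w : Fin J → StrongDual ℝ E)
    (x : Fin J → EuclideanSpace ℝ (Fin n)) : Set E :=
  ⋂ j, {y | w j (Q.Γ (x j)) ≤ w j y}

/-- The data of the initialization phase of the algorithm: unit generators of the dual cone,
optimal solutions of the corresponding weighted sum scalarizations, and the constants `β`, `γ`. -/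
structure InitPhase (Q : CVOP n E) where
  J : ℕ
  w : Fin J → StrongDual ℝ E
  w_unit : ∀ j, ‖w j‖ = 1
  w_generates : dualCone (Q.C : Set E) = conicHull w
  x : Fin J → EuclideanSpace ℝ (Fin n)
  x_optimal : ∀ j, Q.IsWSOptimal (w j) (x j)
  β : ℝ
  β_ge : sSup ((fun x => normalizedSum w (Q.Γ x)) '' Q.feas) ≤ β
  γ : ℝ
  γ_gt : sSup ((fun x => normalizedSum w (Q.Γ x)) '' Q.feas)
      + sSup ((fun v => max (normalizedSum w v - β) 0) ''
          Set.extremePoints ℝ (Q.initialPolyhedron w x))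
      + Metric.hausdorffDist (Q.initialPolyhedron w x) Q.upperImage < γ

namespace InitPhase

variable {Q : CVOP n E}

/-- The functional `w̄`. -/
def wbar (I : Q.InitPhase) : StrongDual ℝ E := normalizedSum I.w

/-- The halfspace `S(γ)`. -/
def halfspace (I : Q.InitPhase) : Set E := {y | I.wbar y ≤ I.γ}

end InitPhase

/-- A run of the outer approximation algorithm without stopping criterion. The sets `out k` are the
outer approximations. For each vertex `v` of some `out k`, the pairs `(xs v, zs v)` and
`(ws v, lams v)` are the solutions of the scalarization at `v` and of its dual that the algorithm
has computed; `vert k` is the selected farthest vertex, and `out k` is cut with the halfspace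
`{y | w̃ (v + z) ≤ w̃ y}`, where `v = vert k`, `z = zs v` and `w̃ = ws v - lams v • w̄`. -/
structure Run {Q : CVOP n E} (I : Q.InitPhase) where
  out : ℕ → Set E
  xs : E → EuclideanSpace ℝ (Fin n)
  zs : E → E
  ws : E → StrongDual ℝ E
  lams : E → ℝ
  vert : ℕ → E
  out_zero : out 0 = Q.initialPolyhedron I.w I.x ∩ I.halfspace
  primal : ∀ k, ∀ v ∈ Set.extremePoints ℝ (out k), Q.PrimalOptimal I.wbar I.γ v (xs v) (zs v)
  dual : ∀ k, ∀ v ∈ Set.extremePoints ℝ (out k), Q.DualOptimal I.wbar I.γ v (ws v) (lams v)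
  vert_mem : ∀ k, vert k ∈ Set.extremePoints ℝ (out k)
  vert_max : ∀ k, ∀ v ∈ Set.extremePoints ℝ (out k), ‖zs v‖ ≤ ‖zs (vert k)‖
  out_succ : ∀ k, out (k + 1) = out k ∩
    {y | (ws (vert k) - lams (vert k) • I.wbar) (vert k + zs (vert k))
      ≤ (ws (vert k) - lams (vert k) • I.wbar) y}

end CVOP

end

open scoped Pointwise
open MeasureTheory

/-! Let `A` be the truncated upper image `P ∩ S(γ)` and `d k` the norm of the selected `z`, which is
the distance from `vert k` to `A`. Strong duality puts `w̃` in the dual unit ball, with `w̃ z = ‖z‖`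
and `w̃ ≥ w̃ (v + z)` on `A`. So each cut keeps `A`, and every later vertex has distance at least `d
j` from `vert j` (`norm_le_dist_vert`). Since `out k` is the closed convex hull of its extreme
points, `d k` bounds the distance to `A` on all of `out k`; hence `d` is antitone and dominates the
Hausdorff error.

The rate is then a volume count. Vertices with `d` in `[ε, 2ε]` are `ε`-separated, so balls of
radius `ε/2` about them are disjoint and lie in a shell around `A` of volume `O(ε)`. There are thus
`O(ε^(1-q))` of them (`exists_shell_packing_bound`), and an induction over doublings of `d` gives
the decay. The constant comes from `A` alone; everything else about the run enters only through `N`.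
-/

/-! ### Volume of thin shells and packing -/

theorem Convex.mem_homothety_of_dist_le {E : Type*} [NormedAddCommGroup E] [NormedSpace ℝ E]
    {A : Set E} (hA : Convex ℝ A) {a : E} {r : ℝ} (hr : 0 < r) (har : Metric.closedBall a r ⊆ A)
    {t : ℝ} (ht : 0 < t) {y p : E} (hp : p ∈ A) (hyp : dist y p ≤ t) :
    y ∈ AffineMap.homothety a (1 + t / r) '' A := by
  have hτ : 0 < t / r := div_pos ht hr
  -- With `τ = t / r`, the preimage of `y` is a convex combination of `p` and a point of the ball
  -- about `a`, displaced by `(y - p) / τ`.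
  refine ⟨(1 / (1 + t / r)) • p + (t / r / (1 + t / r)) • (a + (t / r)⁻¹ • (y - p)), ?_, ?_⟩
  · refine hA hp (har ?_) (by positivity) (by positivity) (by field_simp)
    rw [Metric.mem_closedBall, dist_eq_norm, add_sub_cancel_left, norm_smul, Real.norm_eq_abs,
      abs_of_pos (inv_pos.2 hτ), ← dist_eq_norm]
    calc (t / r)⁻¹ * dist y p ≤ (t / r)⁻¹ * t := by gcongr
      _ = r := by field_simp
  · have h1 : (1 + t / r) ≠ 0 := by positivity
    rw [AffineMap.homothety_apply, vsub_eq_sub, vadd_eq_add, smul_sub, smul_add, smul_smul,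
      smul_smul, mul_one_div_cancel h1, mul_div_cancel₀ _ h1, smul_add, smul_smul,
      mul_inv_cancel₀ hτ.ne']
    module

/-- Convexity of the power on `[1, 1 + s]`; it makes the volume of the shell linear in `ε`. -/
theorem one_add_mul_pow_sub_one_le {s ε : ℝ} (hs : 0 ≤ s) (h0 : 0 ≤ ε) (h1 : ε ≤ 1) (q : ℕ) :
    (1 + ε * s) ^ q - 1 ≤ ε * ((1 + s) ^ q - 1) := by
  have := (convexOn_pow q).2 (show (1 : ℝ) ∈ Set.Ici 0 by simp)
    (show (1 + s) ∈ Set.Ici (0 : ℝ) by simp; linarith) (sub_nonneg.2 h1) h0 (by ring)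
  simp only [smul_eq_mul, mul_one, one_pow] at this
  have e : 1 - ε + ε * (1 + s) = 1 + ε * s := by ring
  rw [e] at this
  linarith

/-- Packing bound for separated points in a thin shell around a convex body. -/
theorem exists_shell_packing_bound {E : Type*} [NormedAddCommGroup E] [NormedSpace ℝ E]
    [FiniteDimensional ℝ E] {A : Set E} (hc : IsCompact A) (hA : Convex ℝ A)
    (hi : (interior A).Nonempty) :
    ∃ K : ℝ, 0 ≤ K ∧ ∀ ε : ℝ, 0 < ε → ε ≤ 1 → ∀ (s : Finset ℕ) (v : ℕ → E),
      (∀ i ∈ s, ε ≤ Metric.infDist (v i) A ∧ Metric.infDist (v i) A ≤ 2 * ε) →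
      (∀ i ∈ s, ∀ j ∈ s, i < j → ε ≤ dist (v i) (v j)) →
      (s.card : ℝ) * ε ^ Module.finrank ℝ E ≤ K * ε := by
  let _ : MeasurableSpace E := borel E
  have : BorelSpace E := ⟨rfl⟩
  let μ : Measure E := Measure.addHaar
  obtain ⟨a, ha⟩ := hi
  obtain ⟨r, hr, har⟩ := Metric.nhds_basis_closedBall.mem_iff.1 (mem_interior_iff_mem_nhds.1 ha)
  set q := Module.finrank ℝ E
  set b := μ.real (Metric.ball (0 : E) 1)
  have hb : 0 < b := by
    refine ENNReal.toReal_pos (Metric.measure_ball_pos μ _ one_pos).ne' measure_ball_lt_top.ne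
  have hpow : 1 ≤ (1 + 3 / r) ^ q := one_le_pow₀ (by have : 0 < 3 / r := by positivity
                                                     linarith)
  refine ⟨2 ^ q * (((1 + 3 / r) ^ q - 1) * μ.real A) / b, ?_, ?_⟩
  · have := sub_nonneg.2 hpow
    positivity
  intro ε hε hε1 s v hv hsep
  have hBall (i : ℕ) : μ.real (Metric.ball (v i) (ε / 2)) = (ε / 2) ^ q * b := by
    rw [measureReal_def, Measure.addHaar_ball_of_pos _ _ (by positivity), ENNReal.toReal_mul,
      ENNReal.toReal_ofReal (by positivity)]
    rfl
  -- Points of the balls are within `2ε + ε/2 ≤ 3ε` of `A`, hence the 3.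
  set B := AffineMap.homothety a (1 + ε * (3 / r)) '' A
  have hBc : IsCompact B := hc.image (AffineMap.homothety_continuous _ _)
  have hBm : μ.real B = (1 + ε * (3 / r)) ^ q * μ.real A := by
    rw [measureReal_def, Measure.addHaar_image_homothety, ENNReal.toReal_mul,
      ENNReal.toReal_ofReal (by positivity), abs_of_nonneg (by positivity)]
    rfl
  have hmemB {y p : E} (hp : p ∈ A) (h : dist y p ≤ 3 * ε) : y ∈ B := by
    have := hA.mem_homothety_of_dist_le hr har (by positivity : 0 < 3 * ε) hp h
    rwa [show 3 * ε / r = ε * (3 / r) by ring] at this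
  have hdisj : (s : Set ℕ).PairwiseDisjoint fun i => Metric.ball (v i) (ε / 2) := by
    intro i hi j hj hij
    refine Metric.ball_disjoint_ball ?_
    rcases lt_or_gt_of_ne hij with h | h
    · linarith [hsep i hi j hj h]
    · linarith [hsep j hj i hi h, dist_comm (v i) (v j)]
  have hdA : Disjoint A (⋃ i ∈ s, Metric.ball (v i) (ε / 2)) := by
    rw [Set.disjoint_left]
    intro y hy hy'
    simp only [Set.mem_iUnion, Metric.mem_ball] at hy'
    obtain ⟨i, his, hi⟩ := hy'
    have := Metric.infDist_le_dist_of_mem (x := v i) hy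
    rw [dist_comm] at this
    linarith [(hv i his).1]
  have hsub : A ∪ (⋃ i ∈ s, Metric.ball (v i) (ε / 2)) ⊆ B := by
    refine Set.union_subset (fun y hy => hmemB hy (by simp; positivity)) ?_
    intro y hy'
    simp only [Set.mem_iUnion, Metric.mem_ball] at hy'
    obtain ⟨i, his, hi⟩ := hy'
    obtain ⟨p, hp, hpd⟩ := hc.exists_infDist_eq_dist ⟨a, interior_subset ha⟩ (v i)
    refine hmemB hp ?_
    have := dist_triangle y (v i) p
    linarith [(hv i his).2]
  have hmeas : MeasurableSet (⋃ i ∈ s, Metric.ball (v i) (ε / 2)) :=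
    Finset.measurableSet_biUnion _ fun i _ => measurableSet_ball
  have h1 := measureReal_mono (μ := μ) hsub hBc.measure_lt_top.ne
  rw [measureReal_union hdA hmeas hc.measure_lt_top.ne
      (((measure_mono (Set.subset_union_right.trans hsub)).trans_lt hBc.measure_lt_top).ne),
    measureReal_biUnion_finset hdisj (fun i _ => measurableSet_ball)
      (fun i _ => measure_ball_lt_top.ne), Finset.sum_congr rfl (fun i _ => hBall i),
    Finset.sum_const, nsmul_eq_mul, hBm] at h1
  have h2 := one_add_mul_pow_sub_one_le (by positivity : 0 ≤ 3 / r) hε.le hε1 q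
  have h3 := mul_le_mul_of_nonneg_right h2 (measureReal_nonneg (μ := μ) (s := A))
  rw [div_mul_eq_mul_div, le_div_iff₀ hb]
  rw [div_pow] at h1
  have h4 : (s.card : ℝ) * (ε ^ q / 2 ^ q * b) ≤ ε * ((1 + 3 / r) ^ q - 1) * μ.real A := by
    linarith
  calc (s.card : ℝ) * ε ^ q * b = 2 ^ q * ((s.card : ℝ) * (ε ^ q / 2 ^ q * b)) := by field_simp
    _ ≤ 2 ^ q * (ε * ((1 + 3 / r) ^ q - 1) * μ.real A) := by gcongr
    _ = _ := by ring

/-! ### From separation to a rate -/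

theorem exists_lt_dist_lt_of_isBounded {E : Type*} [PseudoMetricSpace E] [ProperSpace E]
    {v : ℕ → E} (hv : Bornology.IsBounded (Set.range v)) {ε : ℝ} (hε : 0 < ε) :
    ∃ i j, i < j ∧ dist (v i) (v j) < ε := by
  obtain ⟨a, -, φ, hφ, hlim⟩ := tendsto_subseq_of_bounded hv (fun n => Set.mem_range_self n)
  obtain ⟨N, hN⟩ := Metric.cauchySeq_iff.1 hlim.cauchySeq ε hε
  exact ⟨φ N, φ (N + 1), hφ (Nat.lt_succ_self N), hN N le_rfl (N + 1) (Nat.le_succ N)⟩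

/-- The counting argument behind the convergence rate: an antitone sequence with at most `K / ε ^ p`
terms in each window `[ε, 2 ε]` is eventually `O(k ^ (-1 / p))`. -/
theorem sub_mul_pow_le_of_card_window_le {d : ℕ → ℝ} (hd : Antitone d) (hd0 : ∀ k, 0 ≤ d k)
    {K : ℝ} (hK : 0 ≤ K) {p : ℕ} (hp : 1 ≤ p) {K₀ : ℕ} (hK₀ : d K₀ ≤ 1)
    (hcard : ∀ ε : ℝ, 0 < ε → ε ≤ 1 → ∀ s : Finset ℕ, (∀ i ∈ s, ε ≤ d i ∧ d i ≤ 2 * ε) →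
      (s.card : ℝ) * ε ^ p ≤ K) (k : ℕ) (hk : K₀ ≤ k) :
    ((k : ℝ) - K₀) * d k ^ p ≤ 2 * (K + 1) := by
  induction k using Nat.strong_induction_on with
  | _ k ih =>
  rcases (hd0 k).eq_or_lt with h0 | hε
  · rw [← h0, zero_pow (by omega)]; linarith
  have hε1 : d k ≤ 1 := (hd hk).trans hK₀
  have hεp : d k ^ p ≤ 1 := pow_le_one₀ (hd0 k) hε1
  have hεp0 : 0 ≤ d k ^ p := pow_nonneg (hd0 k) p
  let S := (Finset.Ico K₀ k).filter fun j => d j ≤ 2 * d k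
  let T := (Finset.Ico K₀ k).filter fun j => ¬ d j ≤ 2 * d k
  have hST : S.card + T.card = k - K₀ := by
    rw [Finset.card_filter_add_card_filter_not, Nat.card_Ico]
  have hSTr : ((k : ℝ) - K₀) = S.card + T.card := by
    rw [← Nat.cast_sub hk, ← hST, Nat.cast_add]
  have hS : (S.card : ℝ) * d k ^ p ≤ K := by
    refine hcard (d k) hε hε1 S fun i hi => ?_
    obtain ⟨h1, h2⟩ := Finset.mem_filter.1 hi
    exact ⟨hd (Finset.mem_Ico.1 h1).2.le, h2⟩
  -- `T` ends at the last index `m` with `d m > 2 * d k`. There `d m ^ p ≥ 2 * d k ^ p`, so the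
  -- induction hypothesis is halved to `K + 1`; counting `m` itself costs at most 1 more.
  have hT : (T.card : ℝ) * d k ^ p ≤ K + 1 + 1 := by
    rcases T.eq_empty_or_nonempty with h | h
    · rw [h]; simp; linarith
    obtain ⟨h1, h2⟩ := Finset.mem_filter.1 (T.max'_mem h)
    set m := T.max' h
    obtain ⟨hm1, hm2⟩ := Finset.mem_Ico.1 h1
    have hTc : T.card ≤ m + 1 - K₀ := by
      rw [← Nat.card_Ico]
      refine Finset.card_le_card fun j hj => Finset.mem_Ico.2 ⟨?_, ?_⟩
      · exact (Finset.mem_Ico.1 (Finset.mem_filter.1 hj).1).1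
      · exact Nat.lt_succ_of_le (T.le_max' j hj)
    have hTr : (T.card : ℝ) ≤ (m - K₀) + 1 := by
      have : (T.card : ℝ) ≤ ((m + 1 - K₀ : ℕ) : ℝ) := by exact_mod_cast hTc
      rw [Nat.cast_sub (by omega)] at this
      push_cast at this
      linarith
    have hmK : (0 : ℝ) ≤ m - K₀ := sub_nonneg.2 (by exact_mod_cast hm1)
    have hpow : 2 * d k ^ p ≤ d m ^ p := by
      calc 2 * d k ^ p ≤ 2 ^ p * d k ^ p := by
            gcongr
            exact le_self_pow₀ (by norm_num) (by omega)
        _ = (2 * d k) ^ p := (mul_pow _ _ _).symm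
        _ ≤ d m ^ p := by
            have := hd0 k
            gcongr
            exact (not_le.1 h2).le
    have := (mul_le_mul_of_nonneg_left hpow hmK).trans (ih m hm2 hm1)
    calc (T.card : ℝ) * d k ^ p ≤ ((m - K₀) + 1) * d k ^ p := by gcongr
      _ ≤ K + 1 + 1 := by linarith
  rw [hSTr, add_mul]
  linarith

/-- From `2 * K₀` on, `k - K₀ ≥ k / 2`, so the run-dependent shift only doubles the constant. -/
theorem le_const_mul_rpow_of_sub_mul_pow_le {x D : ℝ} {p k K₀ : ℕ} (hp : 1 ≤ p) (hx : 0 ≤ x)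
    (hD : 0 ≤ D) (hk : 2 * K₀ ≤ k) (hk1 : 1 ≤ k) (h : ((k : ℝ) - K₀) * x ^ p ≤ D) :
    x ≤ (2 * D) ^ (1 / (p : ℝ)) * (k : ℝ) ^ (1 / (-(p : ℝ))) := by
  have hk' : (2 * K₀ : ℝ) ≤ k := by exact_mod_cast hk
  have hk0 : (0 : ℝ) < k := by exact_mod_cast hk1
  have hxp : 0 ≤ x ^ p := pow_nonneg hx p
  have h1 : x ^ p ≤ 2 * D * (k : ℝ)⁻¹ := by
    rw [← div_eq_mul_inv, le_div_iff₀ hk0]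
    have : ((k : ℝ) / 2) * x ^ p ≤ D :=
      (mul_le_mul_of_nonneg_right (by linarith) hxp).trans h
    linarith
  have h2 := Real.rpow_le_rpow hxp h1 (by positivity : 0 ≤ 1 / (p : ℝ))
  rw [Real.mul_rpow (by positivity) (by positivity), one_div, Real.pow_rpow_inv_natCast hx
    (by omega), Real.inv_rpow hk0.le, ← Real.rpow_neg hk0.le] at h2
  rwa [one_div, one_div, inv_neg]

/-- Separated points cutting down towards a convex body approach it at the rate
`k ^ (1 / (1 - dim))`, with a constant that depends only on the body. -/
theorem exists_rate_of_separated {E : Type*} [NormedAddCommGroup E] [NormedSpace ℝ E]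
    [FiniteDimensional ℝ E] {q : ℕ} (hq : 2 ≤ q) (hE : Module.finrank ℝ E = q) (A : Set E) :
    ∃ L : ℝ, IsCompact A → Convex ℝ A → (interior A).Nonempty → ∀ (d : ℕ → ℝ) (v : ℕ → E),
      Antitone d → (∀ k, Metric.infDist (v k) A = d k) →
      (∀ j k, j < k → d j ≤ dist (v j) (v k)) → Bornology.IsBounded (Set.range v) →
      ∃ N : ℕ, ∀ k ≥ N, d k ≤ L * (k : ℝ) ^ (1 / (1 - (q : ℝ))) := by
  by_cases hA : IsCompact A ∧ Convex ℝ A ∧ (interior A).Nonempty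
  swap
  · exact ⟨0, fun h1 h2 h3 => absurd ⟨h1, h2, h3⟩ hA⟩
  obtain ⟨hc, hconv, hi⟩ := hA
  have : ProperSpace E := FiniteDimensional.proper ℝ E
  obtain ⟨K, hK, hpack⟩ := exists_shell_packing_bound hc hconv hi
  obtain ⟨p, rfl⟩ : ∃ p, q = p + 1 := ⟨q - 1, by omega⟩
  have hp : 1 ≤ p := by omega
  refine ⟨(2 * (2 * (K + 1))) ^ (1 / (p : ℝ)), fun _ _ _ d v hd hdv hsep hbdd => ?_⟩
  have hd0 (k : ℕ) : 0 ≤ d k := hdv k ▸ Metric.infDist_nonneg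
  obtain ⟨K₀, j, hij, hlt⟩ := exists_lt_dist_lt_of_isBounded hbdd one_pos
  have hK₀ : d K₀ ≤ 1 := (hsep _ _ hij).trans hlt.le
  have hcard : ∀ ε : ℝ, 0 < ε → ε ≤ 1 → ∀ s : Finset ℕ, (∀ i ∈ s, ε ≤ d i ∧ d i ≤ 2 * ε) →
      (s.card : ℝ) * ε ^ p ≤ K := by
    intro ε hε hε1 s hs
    have := hpack ε hε hε1 s v (fun i hi => by rw [hdv]; exact hs i hi)
      fun i hi j _ hij => (hs i hi).1.trans (hsep i j hij)
    rw [hE, pow_succ, ← mul_assoc] at this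
    exact le_of_mul_le_mul_right this hε
  refine ⟨max (2 * K₀) 1, fun k hk => ?_⟩
  have hk1 : 2 * K₀ ≤ k := (le_max_left _ _).trans hk
  have := le_const_mul_rpow_of_sub_mul_pow_le hp (hd0 k) (by linarith : 0 ≤ 2 * (K + 1)) hk1
    ((le_max_right _ _).trans hk)
    (sub_mul_pow_le_of_card_window_le hd hd0 hK hp hK₀ hcard k (by omega))
  have e : (1 : ℝ) - ((p + 1 : ℕ) : ℝ) = -(p : ℝ) := by push_cast; ring
  rwa [e]

/-- Lagrange multiplier for a single affine constraint under Slater's condition. -/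
theorem Convex.exists_multiplier {E : Type*} [AddCommGroup E] [Module ℝ E] {P : Set E}
    (hP : Convex ℝ P) (f g : E →ₗ[ℝ] ℝ) {γ m : ℝ} (hslater : ∃ y ∈ P, g y < γ)
    (h : ∀ y ∈ P, g y ≤ γ → m ≤ f y) :
    ∃ lam : ℝ, 0 ≤ lam ∧ ∀ y ∈ P, m ≤ f y + lam * (g y - γ) := by
  -- Infeasible points bound the multiplier below, strictly feasible ones above. The bounds are
  -- compatible because the segment joining two such points meets `g = γ`.
  have key {y₁ y₂ : E} (h₁ : y₁ ∈ P) (h₂ : y₂ ∈ P) (hg₁ : γ < g y₁) (hg₂ : g y₂ < γ) :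
      (m - f y₁) / (g y₁ - γ) ≤ (f y₂ - m) / (γ - g y₂) := by
    rw [div_le_div_iff₀ (sub_pos.2 hg₁) (sub_pos.2 hg₂)]
    have hs : 0 < g y₁ - g y₂ := by linarith
    have hmem := hP h₁ h₂ (div_nonneg (sub_pos.2 hg₂).le hs.le)
      (div_nonneg (sub_pos.2 hg₁).le hs.le) (by field_simp; ring)
    have := h _ hmem (by
      simp only [map_add, map_smul, smul_eq_mul]
      refine le_of_eq ?_
      field_simp
      ring)
    simp only [map_add, map_smul, smul_eq_mul] at this
    rw [div_mul_eq_mul_div, div_mul_eq_mul_div, ← add_div, le_div_iff₀ hs] at this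
    linarith
  set S := insert 0 ((fun y => (m - f y) / (g y - γ)) '' {y ∈ P | γ < g y})
  have hub {y₂ : E} (h₂ : y₂ ∈ P) (hg₂ : g y₂ < γ) :
      (f y₂ - m) / (γ - g y₂) ∈ upperBounds S := by
    rintro _ (rfl | ⟨y₁, ⟨h₁, hg₁⟩, rfl⟩)
    · exact div_nonneg (sub_nonneg.2 (h _ h₂ hg₂.le)) (sub_pos.2 hg₂).le
    · exact key h₁ h₂ hg₁ hg₂
  obtain ⟨y₀, hy₀, hgy₀⟩ := hslater
  have hbdd : BddAbove S := ⟨_, hub hy₀ hgy₀⟩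
  have hne : S.Nonempty := ⟨0, Set.mem_insert _ _⟩
  refine ⟨sSup S, le_csSup hbdd (Set.mem_insert _ _), fun y hy => ?_⟩
  rcases lt_trichotomy (g y) γ with hlt | heq | hgt
  · have := csSup_le hne (hub hy hlt)
    rw [le_div_iff₀ (sub_pos.2 hlt)] at this
    linarith
  · simpa [heq] using h y hy heq.le
  · have := le_csSup hbdd (Set.mem_insert_of_mem _ ⟨y, ⟨hy, hgt⟩, rfl⟩)
    rw [div_le_iff₀ (sub_pos.2 hgt)] at this
    linarith

/-! ### The upper image and its truncation -/

namespace CVOP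

variable {n : ℕ} {E : Type*} [NormedAddCommGroup E] [NormedSpace ℝ E]

theorem mem_upperImage {Q : CVOP n E} {y : E} :
    y ∈ Q.upperImage ↔ ∃ x ∈ Q.feas, y - Q.Γ x ∈ Q.C := by
  constructor
  · rintro ⟨_, ⟨x, hx, rfl⟩, c, hc, rfl⟩
    exact ⟨x, hx, by simpa using hc⟩
  · rintro ⟨x, hx, h⟩
    exact ⟨_, ⟨x, hx, rfl⟩, _, h, by simp⟩

theorem map_mem_upperImage (Q : CVOP n E) {x : EuclideanSpace ℝ (Fin n)} (hx : x ∈ Q.feas) :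
    Q.Γ x ∈ Q.upperImage :=
  mem_upperImage.2 ⟨x, hx, by simp⟩

theorem add_mem_upperImage {Q : CVOP n E} {y c : E} (hy : y ∈ Q.upperImage) (hc : c ∈ Q.C) :
    y + c ∈ Q.upperImage := by
  obtain ⟨x, hx, h⟩ := mem_upperImage.1 hy
  exact mem_upperImage.2 ⟨x, hx, by simpa [sub_add_eq_add_sub] using add_mem h hc⟩

theorem smul_mem_cone (Q : CVOP n E) {t : ℝ} (ht : 0 ≤ t) {c : E} (hc : c ∈ Q.C) :
    t • c ∈ Q.C :=
  Q.C.smul_mem hc ht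

theorem convex_upperImage (Q : CVOP n E) : Convex ℝ Q.upperImage := by
  intro y₁ h₁ y₂ h₂ a b ha hb hab
  obtain ⟨x₁, hx₁, hc₁⟩ := mem_upperImage.1 h₁
  obtain ⟨x₂, hx₂, hc₂⟩ := mem_upperImage.1 h₂
  obtain rfl : b = 1 - a := by linarith
  refine mem_upperImage.2 ⟨a • x₁ + (1 - a) • x₂, Q.feas_convex hx₁ hx₂ ha hb hab, ?_⟩
  have := add_mem (add_mem (Q.smul_mem_cone ha hc₁) (Q.smul_mem_cone hb hc₂))
    (Q.Γ_coneConvex x₁ (Q.feas_subset hx₁) x₂ (Q.feas_subset hx₂) a ha (by linarith))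
  convert this using 1
  module

theorem isCompact_image (Q : CVOP n E) : IsCompact (Q.Γ '' Q.feas) :=
  Q.feas_compact.image_of_continuousOn (Q.Γ_continuousOn.mono Q.feas_subset)

theorem isClosed_upperImage (Q : CVOP n E) : IsClosed Q.upperImage :=
  Q.C.isClosed.add_left_of_isCompact Q.isCompact_image

theorem feas_nonempty (Q : CVOP n E) : Q.feas.Nonempty :=
  Q.feas_solid.mono interior_subset

theorem mem_cone_of_forall_dualCone (Q : CVOP n E) {y : E}
    (h : ∀ w ∈ dualCone (Q.C : Set E), 0 ≤ w y) : y ∈ Q.C := by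
  by_contra hy
  obtain ⟨f, hf, hfy⟩ := ProperCone.hyperplane_separation_point Q.C hy
  exact absurd (h f hf) (not_le.2 hfy)

/-- A dual functional vanishing together with its negative is zero, since the cone is solid. -/
theorem eq_zero_of_mem_dualCone (Q : CVOP n E) {w : StrongDual ℝ E}
    (h₁ : w ∈ dualCone (Q.C : Set E)) (h₂ : -w ∈ dualCone (Q.C : Set E)) : w = 0 := by
  have hz : ∀ y ∈ Q.C, w y = 0 := fun y hy => by
    have a := h₁ y hy
    have b := h₂ y hy
    rw [neg_apply] at b
    linarith
  obtain ⟨c, hc⟩ := Q.C_solid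
  have hc' := mem_interior_iff_mem_nhds.1 hc
  obtain ⟨r, hr, hrC⟩ := Metric.nhds_basis_ball.mem_iff.1 hc'
  ext u
  have hlim : Filter.Tendsto (fun t : ℝ => c + t • u) (nhdsWithin 0 (Set.Ioi 0)) (nhds c) := by
    have : Continuous fun t : ℝ => c + t • u := by fun_prop
    simpa using (this.tendsto 0).mono_left nhdsWithin_le_nhds
  obtain ⟨t, ht, ht0⟩ := ((hlim.eventually hc').and self_mem_nhdsWithin).exists
  have := hz _ ht
  rw [map_add, map_smul, hz c (interior_subset hc), zero_add, smul_eq_mul] at this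
  exact (mul_eq_zero.1 this).resolve_left (ne_of_gt ht0)

namespace InitPhase

variable {Q : CVOP n E} (I : Q.InitPhase)

theorem w_mem (j : Fin I.J) : I.w j ∈ dualCone (Q.C : Set E) := by
  rw [I.w_generates]
  refine ⟨Pi.single j 1, fun i => ?_, ?_⟩
  · by_cases h : i = j
    · subst h; simp
    · simp [Pi.single_eq_of_ne h]
  · simp [Pi.single_apply]

theorem J_pos : Nonempty (Fin I.J) := by
  by_contra h
  rw [not_nonempty_iff] at h
  refine Q.C_ne_univ (Set.eq_univ_of_forall fun y => Q.mem_cone_of_forall_dualCone ?_)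
  intro w hw
  rw [I.w_generates] at hw
  obtain ⟨t, -, rfl⟩ := hw
  simp

/-- If the sum vanished, its nonnegative terms would vanish on `C`, which a unit functional cannot
do on a solid cone. -/
theorem norm_sum_pos : 0 < ‖∑ j, I.w j‖ := by
  rw [norm_pos_iff]
  intro h0
  obtain ⟨j⟩ := I.J_pos
  have hneg : -I.w j ∈ dualCone (Q.C : Set E) := by
    intro y hy
    have h := congrArg (fun f : StrongDual ℝ E => f y) h0
    simp only [sum_apply, zero_apply] at h
    have hle : I.w j y ≤ ∑ i, I.w i y :=
      Finset.single_le_sum (f := fun i => I.w i y) (fun i _ => I.w_mem i y hy) (Finset.mem_univ j)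
    rw [neg_apply]
    linarith
  have := I.w_unit j
  rw [Q.eq_zero_of_mem_dualCone (I.w_mem j) hneg, norm_zero] at this
  exact zero_ne_one this

theorem norm_sum_mul_wbar (y : E) : ‖∑ j, I.w j‖ * I.wbar y = ∑ j, I.w j y := by
  rw [wbar, normalizedSum, smul_apply, smul_eq_mul,
    mul_inv_cancel_left₀ I.norm_sum_pos.ne', sum_apply]

/-- The other two terms in the bound on `γ` are nonnegative, whether or not they are finite suprema
or distances. This strictness is the Slater condition. -/
theorem wbar_lt_γ {x : EuclideanSpace ℝ (Fin n)} (hx : x ∈ Q.feas) : I.wbar (Q.Γ x) < I.γ := by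
  have hb : BddAbove ((fun x => normalizedSum I.w (Q.Γ x)) '' Q.feas) := by
    have := Q.isCompact_image.image (normalizedSum I.w).continuous
    rw [Set.image_image] at this
    exact this.bddAbove
  have h1 : I.wbar (Q.Γ x) ≤ sSup ((fun x => normalizedSum I.w (Q.Γ x)) '' Q.feas) :=
    le_csSup hb ⟨x, hx, rfl⟩
  have h2 : 0 ≤ sSup ((fun v => max (normalizedSum I.w v - I.β) 0) ''
      Set.extremePoints ℝ (Q.initialPolyhedron I.w I.x)) := by
    refine Real.sSup_nonneg ?_
    rintro _ ⟨v, -, rfl⟩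
    exact le_max_right _ _
  have h3 : 0 ≤ Metric.hausdorffDist (Q.initialPolyhedron I.w I.x) Q.upperImage :=
    Metric.hausdorffDist_nonneg
  linarith [I.γ_gt]

theorem upperImage_subset_initialPolyhedron : Q.upperImage ⊆ Q.initialPolyhedron I.w I.x := by
  intro y hy
  obtain ⟨x, hx, hc⟩ := mem_upperImage.1 hy
  refine Set.mem_iInter.2 fun j => ?_
  have h1 := I.w_mem j _ hc
  have h2 := (I.x_optimal j).2 x hx
  rw [map_sub] at h1
  exact h2.trans (sub_nonneg.1 h1)

theorem isClosed_initial : IsClosed (Q.initialPolyhedron I.w I.x ∩ I.halfspace) :=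
  (isClosed_iInter fun j => isClosed_le continuous_const (I.w j).continuous).inter
    (isClosed_le I.wbar.continuous continuous_const)

theorem convex_initial : Convex ℝ (Q.initialPolyhedron I.w I.x ∩ I.halfspace) :=
  (convex_iInter fun j => convex_halfSpace_ge (I.w j).toLinearMap.isLinear _).inter
    (convex_halfSpace_le I.wbar.toLinearMap.isLinear _)

/-- Pointedness makes the `w j` jointly injective. Each is bounded below on the set, and `w̄ ≤ γ`
bounds their sum above, so all lie in a box. -/
theorem isBounded_initial [FiniteDimensional ℝ E] :
    Bornology.IsBounded (Q.initialPolyhedron I.w I.x ∩ I.halfspace) := by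
  let L : E →ₗ[ℝ] (Fin I.J → ℝ) := LinearMap.pi fun j => (I.w j).toLinearMap
  have hL : LinearMap.ker L = ⊥ := by
    rw [LinearMap.ker_eq_bot']
    intro y hy
    have hj (j) : I.w j y = 0 := congrFun hy j
    have hw : ∀ w ∈ dualCone (Q.C : Set E), w y = 0 := by
      intro w hw
      rw [I.w_generates] at hw
      obtain ⟨t, -, rfl⟩ := hw
      simp [hj]
    exact Q.C_pointed y (Q.mem_cone_of_forall_dualCone fun w h => (hw w h).ge)
      (Q.mem_cone_of_forall_dualCone fun w h => by rw [map_neg, hw w h, neg_zero])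
  obtain ⟨K, -, hK⟩ := L.exists_antilipschitzWith hL
  let a : Fin I.J → ℝ := fun j => I.w j (Q.Γ (I.x j))
  refine (hK.isBounded_preimage (Metric.isBounded_Icc a
    fun i => ‖∑ j, I.w j‖ * I.γ - ∑ j, a j + a i)).subset ?_
  rintro y ⟨hy, hyγ⟩
  have hlow (j) : a j ≤ I.w j y := Set.mem_iInter.1 hy j
  refine ⟨hlow, fun i => ?_⟩
  have h1 : I.w i y - a i ≤ ∑ j, (I.w j y - a j) :=
    Finset.single_le_sum (f := fun j => I.w j y - a j) (fun j _ => sub_nonneg.2 (hlow j))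
      (Finset.mem_univ i)
  rw [Finset.sum_sub_distrib, ← I.norm_sum_mul_wbar] at h1
  have h2 : ‖∑ j, I.w j‖ * I.wbar y ≤ ‖∑ j, I.w j‖ * I.γ :=
    mul_le_mul_of_nonneg_left hyγ (norm_nonneg _)
  change I.w i y ≤ _
  linarith

theorem isCompact_initial [FiniteDimensional ℝ E] :
    IsCompact (Q.initialPolyhedron I.w I.x ∩ I.halfspace) :=
  have : ProperSpace E := FiniteDimensional.proper ℝ E
  Metric.isCompact_of_isClosed_isBounded I.isClosed_initial I.isBounded_initial

theorem body_subset_initial :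
    Q.upperImage ∩ I.halfspace ⊆ Q.initialPolyhedron I.w I.x ∩ I.halfspace :=
  Set.inter_subset_inter_left _ I.upperImage_subset_initialPolyhedron

theorem convex_body : Convex ℝ (Q.upperImage ∩ I.halfspace) :=
  Q.convex_upperImage.inter (convex_halfSpace_le I.wbar.toLinearMap.isLinear _)

theorem isCompact_body [FiniteDimensional ℝ E] : IsCompact (Q.upperImage ∩ I.halfspace) :=
  I.isCompact_initial.of_isClosed_subset
    (Q.isClosed_upperImage.inter (isClosed_le I.wbar.continuous continuous_const))
    I.body_subset_initial

theorem map_mem_body {x : EuclideanSpace ℝ (Fin n)} (hx : x ∈ Q.feas) :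
    Q.Γ x ∈ Q.upperImage ∩ I.halfspace :=
  ⟨Q.map_mem_upperImage hx, (I.wbar_lt_γ hx).le⟩

theorem body_nonempty : (Q.upperImage ∩ I.halfspace).Nonempty :=
  let ⟨_, hx⟩ := Q.feas_nonempty
  ⟨_, I.map_mem_body hx⟩

theorem body_solid : (interior (Q.upperImage ∩ I.halfspace)).Nonempty := by
  obtain ⟨x, hx⟩ := Q.feas_nonempty
  obtain ⟨c, hc⟩ := Q.C_solid
  have hlim : Filter.Tendsto (fun t : ℝ => I.wbar (Q.Γ x + t • c)) (nhdsWithin 0 (Set.Ioi 0))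
      (nhds (I.wbar (Q.Γ x))) := by
    have : Continuous fun t : ℝ => I.wbar (Q.Γ x + t • c) := by fun_prop
    simpa using (this.tendsto 0).mono_left nhdsWithin_le_nhds
  obtain ⟨t, ht, ht0⟩ :=
    ((hlim.eventually (gt_mem_nhds (I.wbar_lt_γ hx))).and self_mem_nhdsWithin).exists
  have ht0' : (0 : ℝ) < t := ht0
  let O : Set E := {y | t⁻¹ • (y - Q.Γ x) ∈ interior (Q.C : Set E)} ∩ {y | I.wbar y < I.γ}
  have hO : IsOpen O := by
    refine IsOpen.inter ?_ (isOpen_lt I.wbar.continuous continuous_const)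
    exact isOpen_interior.preimage (by fun_prop : Continuous fun y : E => t⁻¹ • (y - Q.Γ x))
  have hOs : O ⊆ Q.upperImage ∩ I.halfspace := by
    rintro y ⟨h1, h2⟩
    refine ⟨mem_upperImage.2 ⟨x, hx, ?_⟩, show I.wbar y ≤ I.γ from le_of_lt h2⟩
    have := Q.smul_mem_cone ht0'.le (interior_subset h1)
    rwa [smul_inv_smul₀ ht0'.ne'] at this
  refine ⟨Q.Γ x + t • c, interior_maximal hOs hO ⟨?_, ht⟩⟩
  simpa [inv_smul_smul₀ ht0'.ne'] using hc

end InitPhase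

end CVOP

/-! ### Scalarization and strong duality -/

/-- A functional of norm at most one separating a ball around `v` from a convex set. -/
theorem Convex.exists_separating_of_le_dist {E : Type*} [NormedAddCommGroup E] [NormedSpace ℝ E]
    {A : Set E} (hA : Convex ℝ A) {v : E} {r : ℝ} (hr : 0 < r)
    (h : ∀ y ∈ A, r ≤ dist v y) :
    ∃ f : StrongDual ℝ E, (∀ u, f u ≤ ‖u‖) ∧ ∀ y ∈ A, f v + r ≤ f y := by
  have hdisj : Disjoint (Metric.ball v r) A := by
    rw [Set.disjoint_left]
    intro y hy hyA
    rw [Metric.mem_ball, dist_comm] at hy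
    exact absurd (h y hyA) (not_le.2 hy)
  obtain ⟨f, b, hf, hfA⟩ := geometric_hahn_banach_open (convex_ball v r) Metric.isOpen_ball hA hdisj
  have hlt {z : E} (hz : ‖z‖ < 1) : r * f z < b - f v := by
    have := hf (v + r • z) (by
      rw [Metric.mem_ball, dist_eq_norm, add_sub_cancel_left, norm_smul, Real.norm_eq_abs,
        abs_of_pos hr]
      exact mul_lt_of_lt_one_right hr hz)
    rw [map_add, map_smul, smul_eq_mul] at this
    linarith
  have hpos : 0 < b - f v := by linarith [hf v (Metric.mem_ball_self hr)]
  refine ⟨(r / (b - f v)) • f, fun u => ?_, fun y hy => ?_⟩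
  · rw [smul_apply, smul_eq_mul]
    by_contra! hu
    set s := r / (b - f v) * f u with hs
    have hs0 : 0 < s := (norm_nonneg u).trans_lt hu
    have h1 := hlt (z := s⁻¹ • u) (by
      rw [norm_smul, Real.norm_eq_abs, abs_of_pos (inv_pos.2 hs0), inv_mul_lt_iff₀ hs0, mul_one]
      exact hu)
    have h2 : r * f u = s * (b - f v) := by rw [hs]; field_simp
    rw [map_smul, smul_eq_mul, mul_left_comm, h2, inv_mul_cancel_left₀ hs0.ne'] at h1
    exact lt_irrefl _ h1
  · have h1 : r / (b - f v) * (b - f v) ≤ r / (b - f v) * (f y - f v) :=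
      mul_le_mul_of_nonneg_left (by linarith [hfA y hy]) (by positivity)
    rw [div_mul_cancel₀ _ hpos.ne'] at h1
    simp only [smul_apply, smul_eq_mul]
    linarith

namespace CVOP

variable {n : ℕ} {E : Type*} [NormedAddCommGroup E] [NormedSpace ℝ E] {Q : CVOP n E}

theorem PrimalFeasible.add_mem_body {I : Q.InitPhase} {v z : E} {x : EuclideanSpace ℝ (Fin n)}
    (h : Q.PrimalFeasible I.wbar I.γ v x z) : v + z ∈ Q.upperImage ∩ I.halfspace :=
  ⟨mem_upperImage.2 ⟨x, h.1, h.2.1⟩, h.2.2⟩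

theorem PrimalOptimal.norm_le_dist {I : Q.InitPhase} {v z : E} {x : EuclideanSpace ℝ (Fin n)}
    (h : Q.PrimalOptimal I.wbar I.γ v x z) {y : E} (hy : y ∈ Q.upperImage ∩ I.halfspace) :
    ‖z‖ ≤ dist v y := by
  obtain ⟨x', hx', hc⟩ := mem_upperImage.1 hy.1
  rw [dist_eq_norm, norm_sub_rev]
  refine h.2 x' (y - v) ⟨hx', ?_, ?_⟩
  · rwa [add_sub_cancel]
  · rw [add_sub_cancel]; exact hy.2

theorem PrimalOptimal.infDist_eq {I : Q.InitPhase} {v z : E} {x : EuclideanSpace ℝ (Fin n)}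
    (h : Q.PrimalOptimal I.wbar I.γ v x z) :
    Metric.infDist v (Q.upperImage ∩ I.halfspace) = ‖z‖ := by
  refine le_antisymm ?_ ?_
  · simpa using Metric.infDist_le_dist_of_mem (x := v) h.1.add_mem_body
  · exact (Metric.le_infDist I.body_nonempty).2 fun _ hy => h.norm_le_dist hy

/-- Strong duality: some dual feasible pair attains the primal optimal value. -/
theorem PrimalOptimal.exists_dual {I : Q.InitPhase} {v z : E} {x : EuclideanSpace ℝ (Fin n)}
    (h : Q.PrimalOptimal I.wbar I.γ v x z) :
    ∃ w ∈ dualCone (Q.C : Set E), ∃ lam : ℝ, 0 ≤ lam ∧ ∀ x' ∈ Q.feas, ∀ z' : E,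
      ‖z‖ ≤ ‖z'‖ + w (Q.Γ x' - z' - v) + lam * (I.wbar (v + z') - I.γ) := by
  rcases (norm_nonneg z).eq_or_lt with h0 | hpos
  · exact ⟨0, fun _ _ => by simp, 0, le_rfl, fun x' _ z' => by simp [← h0]⟩
  obtain ⟨f, hf1, hf⟩ := I.convex_body.exists_separating_of_le_dist hpos
    fun y hy => h.norm_le_dist hy
  obtain ⟨x₀, hx₀⟩ := Q.feas_nonempty
  obtain ⟨lam, hlam, hm⟩ := Q.convex_upperImage.exists_multiplier f.toLinearMap
    I.wbar.toLinearMap ⟨_, Q.map_mem_upperImage hx₀, I.wbar_lt_γ hx₀⟩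
    (fun y hy hg => hf y ⟨hy, hg⟩)
  simp only [ContinuousLinearMap.coe_coe] at hm
  -- With this `w`, the functional `w - lam • w̄` is the separator `f`. It is nonnegative on `C`,
  -- since otherwise a ray in `C` would violate the lower bound `hm`.
  refine ⟨f + lam • I.wbar, ?_, lam, hlam, ?_⟩
  · intro c hc
    by_contra hneg
    push Not at hneg
    set e := (f + lam • I.wbar) c with he
    have hray (t : ℝ) (ht : 0 ≤ t) :
        f v + ‖z‖ ≤ f (Q.Γ x₀) + lam * (I.wbar (Q.Γ x₀) - I.γ) + t * e := by
      have := hm _ (add_mem_upperImage (Q.map_mem_upperImage hx₀) (Q.smul_mem_cone ht hc))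
      simp only [map_add, map_smul, smul_eq_mul] at this
      simp only [he, add_apply, smul_apply, smul_eq_mul]
      linarith
    set b := f (Q.Γ x₀) + lam * (I.wbar (Q.Γ x₀) - I.γ) - (f v + ‖z‖)
    have hb : 0 ≤ b := by linarith [hray 0 le_rfl]
    have := hray ((b + 1) / -e) (div_nonneg (by linarith) (by linarith))
    have e1 : (b + 1) / -e * e = -(b + 1) := by
      have := hneg.ne
      field_simp
    rw [e1] at this
    linarith
  · intro x' hx' z'
    have h1 := hm _ (Q.map_mem_upperImage hx')
    have h2 := hf1 z'
    simp only [add_apply, smul_apply, smul_eq_mul, map_sub, map_add]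
    linarith

theorem DualOptimal.norm_le {I : Q.InitPhase} {v z : E} {x : EuclideanSpace ℝ (Fin n)}
    {w : StrongDual ℝ E} {lam : ℝ} (hd : Q.DualOptimal I.wbar I.γ v w lam)
    (hp : Q.PrimalOptimal I.wbar I.γ v x z) {x' : EuclideanSpace ℝ (Fin n)} (hx' : x' ∈ Q.feas)
    (z' : E) : ‖z‖ ≤ ‖z'‖ + w (Q.Γ x' - z' - v) + lam * (I.wbar (v + z') - I.γ) := by
  obtain ⟨w', hw', lam', hlam', h⟩ := hp.exists_dual
  have h1 : ((‖z‖ : ℝ) : EReal) ≤ Q.dualObjective I.wbar I.γ v w' lam' :=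
    le_iInf₂ fun x' hx' => le_iInf fun z' => EReal.coe_le_coe_iff.2 (h x' hx' z')
  have h2 : Q.dualObjective I.wbar I.γ v w lam ≤
      ((‖z'‖ + w (Q.Γ x' - z' - v) + lam * (I.wbar (v + z') - I.γ) : ℝ) : EReal) :=
    (iInf₂_le x' hx').trans (iInf_le _ z')
  exact EReal.coe_le_coe_iff.1 ((h1.trans (hd.2.2 w' hw' lam' hlam')).trans h2)

/-- Otherwise moving `z` along the ray of `u` would drive the Lagrangian to `-∞`, below the optimal
value. -/
theorem DualOptimal.apply_le_norm {I : Q.InitPhase} {v z : E} {x : EuclideanSpace ℝ (Fin n)}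
    {w : StrongDual ℝ E} {lam : ℝ} (hd : Q.DualOptimal I.wbar I.γ v w lam)
    (hp : Q.PrimalOptimal I.wbar I.γ v x z) (u : E) : (w - lam • I.wbar) u ≤ ‖u‖ := by
  by_contra! hlt
  obtain ⟨x₀, hx₀⟩ := Q.feas_nonempty
  set e := (w - lam • I.wbar) u - ‖u‖ with he
  have hepos : 0 < e := sub_pos.2 hlt
  set b := w (Q.Γ x₀ - v) + lam * (I.wbar v - I.γ) - ‖z‖ with hb
  have hray (t : ℝ) (ht : 0 ≤ t) : t * e ≤ b := by
    have := hd.norm_le hp hx₀ (t • u)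
    rw [norm_smul, Real.norm_eq_abs, abs_of_nonneg ht] at this
    simp only [map_sub, map_add, map_smul, smul_eq_mul] at this
    simp only [he, hb, sub_apply, smul_apply, smul_eq_mul, map_sub]
    linarith
  have hb0 : 0 ≤ b := by linarith [hray 0 le_rfl]
  have := hray ((b + 1) / e) (by positivity)
  rw [div_mul_cancel₀ _ hepos.ne'] at this
  linarith

/-- The Lagrangian bound at `z' = 0`; the parts from `C` and from `S(γ)` have the right sign. -/
theorem DualOptimal.add_norm_le {I : Q.InitPhase} {v z : E} {x : EuclideanSpace ℝ (Fin n)}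
    {w : StrongDual ℝ E} {lam : ℝ} (hd : Q.DualOptimal I.wbar I.γ v w lam)
    (hp : Q.PrimalOptimal I.wbar I.γ v x z) {y : E} (hy : y ∈ Q.upperImage ∩ I.halfspace) :
    (w - lam • I.wbar) v + ‖z‖ ≤ (w - lam • I.wbar) y := by
  obtain ⟨x', hx', hc⟩ := mem_upperImage.1 hy.1
  have h1 := hd.norm_le hp hx' 0
  have h2 := hd.1 _ hc
  have h3 : lam * I.wbar y ≤ lam * I.γ := mul_le_mul_of_nonneg_left hy.2 hd.2.1
  simp only [norm_zero, sub_zero, add_zero, zero_add, map_sub] at h1 h2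
  simp only [sub_apply, smul_apply, smul_eq_mul]
  linarith

theorem DualOptimal.apply_eq_norm {I : Q.InitPhase} {v z : E} {x : EuclideanSpace ℝ (Fin n)}
    {w : StrongDual ℝ E} {lam : ℝ} (hd : Q.DualOptimal I.wbar I.γ v w lam)
    (hp : Q.PrimalOptimal I.wbar I.γ v x z) : (w - lam • I.wbar) z = ‖z‖ := by
  have h := hd.add_norm_le hp hp.1.add_mem_body
  rw [map_add] at h
  exact le_antisymm (hd.apply_le_norm hp z) (by linarith)

/-! ### Geometry of a run -/

namespace Run

variable {I : Q.InitPhase} (R : Run I)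

theorem primal_vert (k : ℕ) :
    Q.PrimalOptimal I.wbar I.γ (R.vert k) (R.xs (R.vert k)) (R.zs (R.vert k)) :=
  R.primal k _ (R.vert_mem k)

theorem dual_vert (k : ℕ) :
    Q.DualOptimal I.wbar I.γ (R.vert k) (R.ws (R.vert k)) (R.lams (R.vert k)) :=
  R.dual k _ (R.vert_mem k)

theorem out_antitone : Antitone R.out :=
  antitone_nat_of_succ_le fun k => by rw [R.out_succ]; exact Set.inter_subset_left

theorem convex_isClosed_out (k : ℕ) : Convex ℝ (R.out k) ∧ IsClosed (R.out k) := by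
  induction k with
  | zero => rw [R.out_zero]; exact ⟨I.convex_initial, I.isClosed_initial⟩
  | succ k ih =>
    rw [R.out_succ]
    exact ⟨ih.1.inter (convex_halfSpace_ge (ContinuousLinearMap.toLinearMap _).isLinear _),
      ih.2.inter (isClosed_le continuous_const (ContinuousLinearMap.continuous _))⟩

theorem out_subset_initial (k : ℕ) :
    R.out k ⊆ Q.initialPolyhedron I.w I.x ∩ I.halfspace := by
  rw [← R.out_zero]
  exact R.out_antitone (Nat.zero_le k)

theorem isCompact_out [FiniteDimensional ℝ E] (k : ℕ) : IsCompact (R.out k) :=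
  I.isCompact_initial.of_isClosed_subset (R.convex_isClosed_out k).2 (R.out_subset_initial k)

theorem vert_mem_out (k : ℕ) : R.vert k ∈ R.out k := extremePoints_subset (R.vert_mem k)

theorem body_subset_out (k : ℕ) : Q.upperImage ∩ I.halfspace ⊆ R.out k := by
  induction k with
  | zero => rw [R.out_zero]; exact I.body_subset_initial
  | succ k ih =>
    rw [R.out_succ]
    refine fun y hy => ⟨ih hy, ?_⟩
    have h1 := (R.dual_vert k).add_norm_le (R.primal_vert k) hy
    have h2 := (R.dual_vert k).apply_eq_norm (R.primal_vert k)
    rw [Set.mem_ofPred_eq, map_add, h2]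
    exact h1

/-- `vert k` satisfies the cut made at step `j`, on whose boundary `w̃` exceeds its value at `vert
j` by `‖z‖`, and `w̃` is 1-Lipschitz. -/
theorem norm_le_dist_vert {j k : ℕ} (hjk : j < k) :
    ‖R.zs (R.vert j)‖ ≤ dist (R.vert j) (R.vert k) := by
  have hmem := R.out_antitone (Nat.succ_le_of_lt hjk) (R.vert_mem_out k)
  rw [Nat.succ_eq_add_one, R.out_succ] at hmem
  have h1 := hmem.2
  have h2 := (R.dual_vert j).apply_eq_norm (R.primal_vert j)
  have h3 := (R.dual_vert j).apply_le_norm (R.primal_vert j) (R.vert k - R.vert j)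
  rw [Set.mem_ofPred_eq, map_add, h2] at h1
  rw [map_sub] at h3
  rw [dist_eq_norm, norm_sub_rev]
  linarith

/-- Krein–Milman: a closed convex thickening that contains the extreme points contains the whole
set. -/
theorem out_subset_cthickening [FiniteDimensional ℝ E] (k : ℕ) :
    R.out k ⊆ Metric.cthickening ‖R.zs (R.vert k)‖ (Q.upperImage ∩ I.halfspace) := by
  rw [← closure_convexHull_extremePoints (R.isCompact_out k) (R.convex_isClosed_out k).1]
  refine closure_minimal (convexHull_min (fun v hv => ?_) (I.convex_body.cthickening _))
    Metric.isClosed_cthickening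
  have hp := R.primal k v hv
  refine Metric.mem_cthickening_of_dist_le _ _ _ _ hp.1.add_mem_body ?_
  simpa using R.vert_max k v hv

theorem infDist_le_of_mem_out [FiniteDimensional ℝ E] {k : ℕ} {y : E} (hy : y ∈ R.out k) :
    Metric.infDist y (Q.upperImage ∩ I.halfspace) ≤ ‖R.zs (R.vert k)‖ :=
  ENNReal.toReal_le_of_le_ofReal (norm_nonneg _)
    (Metric.mem_cthickening_iff.1 (R.out_subset_cthickening k hy))

theorem antitone_norm [FiniteDimensional ℝ E] : Antitone fun k => ‖R.zs (R.vert k)‖ := by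
  intro j k hjk
  change ‖R.zs (R.vert k)‖ ≤ ‖R.zs (R.vert j)‖
  rw [← (R.primal_vert k).infDist_eq]
  exact R.infDist_le_of_mem_out (R.out_antitone hjk (R.vert_mem_out k))

theorem hausdorffEDist_le [FiniteDimensional ℝ E] (k : ℕ) :
    Metric.hausdorffEDist (R.out k + (Q.C : Set E)) Q.upperImage ≤
      ENNReal.ofReal ‖R.zs (R.vert k)‖ := by
  refine Metric.hausdorffEDist_le_of_mem_edist ?_ ?_
  · rintro _ ⟨y, hy, c, hc, rfl⟩
    obtain ⟨p, hp, hpd⟩ := I.isCompact_body.exists_infDist_eq_dist I.body_nonempty y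
    refine ⟨p + c, add_mem_upperImage hp.1 hc, ?_⟩
    rw [edist_dist]
    refine ENNReal.ofReal_le_ofReal ?_
    change dist (y + c) (p + c) ≤ _
    rw [dist_add_right, ← hpd]
    exact R.infDist_le_of_mem_out hy
  -- This direction has error zero: `Γ x` lies in the truncation, hence in `out k`, and adding `C`
  -- recovers the whole upper image.
  · intro y hy
    obtain ⟨x, hx, hc⟩ := mem_upperImage.1 hy
    refine ⟨y, ⟨_, R.body_subset_out k (I.map_mem_body hx), _, hc, by simp⟩, by simp⟩

end Run

end CVOP

theorem mainTheorem2 {E : Type*} [NormedAddCommGroup E] [NormedSpace ℝ E] [FiniteDimensional ℝ E]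
    (q : ℕ) (hq : 2 ≤ q) (hE : Module.finrank ℝ E = q) :
    ∃ Λ : Set E → ℝ,
      ∀ (n : ℕ) (Q : CVOP n E), IsPolyhedralSet (Q.C : Set E) →
        ∀ (I : Q.InitPhase) (R : CVOP.Run I),
          ∃ N : ℕ, ∀ k : ℕ, N ≤ k →
            Metric.hausdorffEDist (R.out k + (Q.C : Set E)) Q.upperImage ≠ ⊤ ∧
            Metric.hausdorffDist (R.out k + (Q.C : Set E)) Q.upperImage
              ≤ Λ (Q.upperImage ∩ I.halfspace) * (k : ℝ) ^ (1 / (1 - (q : ℝ))) := by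
  choose Λ hΛ using exists_rate_of_separated (E := E) hq hE
  refine ⟨Λ, fun n Q _ I R => ?_⟩
  have hbdd : Bornology.IsBounded (Set.range R.vert) := by
    refine I.isBounded_initial.subset ?_
    rintro _ ⟨k, rfl⟩
    exact R.out_subset_initial k (R.vert_mem_out k)
  obtain ⟨N, hN⟩ := hΛ _ I.isCompact_body I.convex_body I.body_solid _ R.vert R.antitone_norm
    (fun k => (R.primal_vert k).infDist_eq) (fun j k hjk => R.norm_le_dist_vert hjk) hbdd
  refine ⟨N, fun k hk => ⟨ne_top_of_le_ne_top ENNReal.ofReal_ne_top (R.hausdorffEDist_le k), ?_⟩⟩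
  exact (ENNReal.toReal_le_of_le_ofReal (norm_nonneg _) (R.hausdorffEDist_le k)).trans (hN k hk)
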